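/- Consider an arm of a restless bandit given by a Gilbert--Elliot channel: a two-state Markov chain (state $1$ good, state $0$ bad) with transition probabilities $p_{01},p_{11}\in[0,1]$ (from bad to good, and from good to good), $p_{10}=1-p_{11}$, and transmission rate $B\ge 0$. Its belief state is the probability $\omega\in[0,1]$ that the channel is good. In each slot the arm is made active, which yields the expected reward $\omega B$, the next belief state being $p_{11}$ with probability $\omega$ and $p_{01}$ with probability $1-\omega$; or it is made passive, which yields a subsidy $m\in\mathbb{R}$, the next belief state being $\mathcal T(\omega)=\omega p_{11}+(1-\omega)p_{01}$. Let $0\le\beta<1$, let $V_{\beta,m}(\omega)$ be the maximum expected total $\beta$-discounted reward over all policies from initial belief state $\omega$, and put $V_{\beta,m}(\omega;0)=m+\beta V_{\beta,m}(\mathcal T(\omega))$ and $V_{\beta,m}(\omega;1)=\omega B+\beta(\omega V_{\beta,m}(p_{11})+(1-\omega)V_{\beta,m}(p_{01}))$. The passive set is $\mathcal P(m)=\{\omega\in[0,1]: V_{\beta,m}(\omega;0)\ge V_{\beta,m}(\omega;1)\}$, and Whittle's index is $W_\beta(\omega)=\inf\{m:\omega\in\mathcal P(m)\}$. Let $\mathcal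 T^k$ be the $k$-fold iterate of $\mathcal T$, let $\omega_o=\frac{p_{01}}{p_{01}+p_{10}}$ (with $\omega_o=0$ if $p_{01}=p_{10}=0$), and let $L(\omega,\omega')=\min\{k\ge 0:\mathcal T^k(\omega)>\omega'\}$ (with $L=\infty$ if there is no such $k$). Then the arm is indexable, that is, $\mathcal P(m)$ is increasing in $m$, is empty for all sufficiently small $m$, and is $[0,1]$ for all sufficiently large $m$ (so that $W_\beta(\omega)\in\mathbb{R}$); and for every $\omega\in[0,1]$, Whittle's index is given as follows. Case 1 (positively correlated, $p_{11}\ge p_{01}$): $$W_\beta(\omega)=\begin{cases}\omega B, & \omega\le p_{01}\text{ or }\omega\ge p_{11},\\[1ex] \dfrac{\omega}{1-\beta p_{11}+\beta\omega}\,B, & \omega_o\le\omega<p_{11},\\[2ex] \dfrac{\omega-\beta\mathcal T(\omega)+C_2(1-\beta)\bigl(\beta(1-\beta p_{11})-\beta(\omega-\beta\mathcal T(\omega))\bigr)}{1-\beta p_{11}-C_1\bigl(\beta(1-\beta p_{11})-\beta(\omega-\beta\mathcal T(\omega))\bigr)}\,B, & p_{01}<\omega<\omega_o,\end{cases}$$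 where in the last case $L=L(p_{01},\omega)$ is finite and $$C_1=\frac{(1-\beta p_{11})(1-\beta^{L})}{(1-\beta p_{11})(1-\beta^{L+1})+(1-\beta)\beta^{L+1}\mathcal T^{L}(p_{01})},\qquad C_2=\frac{\beta^{L}\mathcal T^{L}(p_{01})}{(1-\beta p_{11})(1-\beta^{L+1})+(1-\beta)\beta^{L+1}\mathcal T^{L}(p_{01})}.$$ Case 2 (negatively correlated, $p_{11}<p_{01}$): $$W_\beta(\omega)=\begin{cases}\omega B, & \omega\le p_{11}\text{ or }\omega\ge p_{01},\\[1ex] \dfrac{\beta p_{01}+\omega(1-\beta)}{1+\beta(p_{01}-\omega)}\,B, & \mathcal T(p_{11})\le\omega<p_{01},\\[2ex] \dfrac{(1-\beta+\beta C_4)(\beta p_{01}+\omega(1-\beta))}{1-\beta(1-p_{01})-C_3(\beta^2p_{01}+\beta\omega-\beta^2\omega)}\,B, & \omega_o\le\omega<\mathcal T(p_{11}),\\[2ex] \dfrac{(1-\beta)(\beta p_{01}+\omega-\beta\mathcal T(\omega))-C_4\beta(\beta\mathcal T(\omega)-\beta p_{01}-\omega)}{1-\beta(1-p_{01})+C_3\beta(\beta\mathcal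 T(\omega)-\beta p_{01}-\omega)}\,B, & p_{11}<\omega<\omega_o,\end{cases}$$ where $$C_3=\frac{1-\beta(1-p_{01})}{1+(1+\beta)\beta p_{01}-\beta^2\mathcal T(p_{11})},\qquad C_4=\frac{\beta\mathcal T(p_{11})(1-\beta)+\beta^2p_{01}}{1+(1+\beta)\beta p_{01}-\beta^2\mathcal T(p_{11})}.$$ -/

import Mathlib

noncomputable section

namespace Whittle

/-- An arm: a Gilbert-Elliot channel, i.e. a two-state Markov chain (`1` good, `0` bad), together
with the rate `B` that is collected when the channel is sensed in the good state. -/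
structure Arm where
  /-- probability of moving from the bad to the good state -/
  p01 : ℝ
  /-- probability of moving from the good to the good state -/
  p11 : ℝ
  /-- transmission rate -/
  B : ℝ
  p01_mem : p01 ∈ Set.Icc (0 : ℝ) 1
  p11_mem : p11 ∈ Set.Icc (0 : ℝ) 1
  B_nonneg : 0 ≤ B

/-- The two actions that can be taken in a slot. -/
inductive Action where
  | passive
  | active

/-- A policy prescribes an action for every slot and every current belief state. -/
abbrev Policy : Type := ℕ → ℝ → Action

namespace Arm

variable (A : Arm)

/-- Probability of moving from the good to the bad state. -/
def p10 : ℝ := 1 - A.p11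

/-- Belief update of an unobserved arm. Its iterate `A.T^[k]` is the `k`-step update. -/
def T (ω : ℝ) : ℝ := ω * A.p11 + (1 - ω) * A.p01

/-- The stationary probability of the good state. For the identity transition matrix, which has
many stationary distributions, this is the stationary probability `0`. -/
def ωo : ℝ := A.p01 / (A.p01 + A.p10)

/-- The crossing time `min {k : T^k(ω) > ω'}`, equal to `⊤` if there is no such `k`. -/
def crossingTime (ω ω' : ℝ) : ℕ∞ := sInf ((fun k : ℕ => (k : ℕ∞)) '' {k : ℕ | ω' < A.T^[k] ω})

/-! ### The single-armed bandit process with subsidy `m` -/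

/-- Expected reward of one slot in belief state `ω`: the subsidy `m` if the arm is passive, and
`ω B` if it is active. -/
def reward (m : ℝ) (ω : ℝ) : Action → ℝ
  | .passive => m
  | .active => ω * A.B

/-- Expectation of `f` at the next belief state, from belief state `ω`: a passive arm moves to
`T ω`; an active arm is observed to be good with probability `ω`, and then moves to `p11`, and
bad with probability `1 - ω`, and then moves to `p01`. -/
def expNext (f : ℝ → ℝ) (ω : ℝ) : Action → ℝ
  | .passive => f (A.T ω)
  | .active => ω * f A.p11 + (1 - ω) * f A.p01

/-- Expected reward of slot `t` (slots are counted from `0`) under the policy `π`, from the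
initial belief state `ω`. The policy used from the second slot on is `fun s => π (s + 1)`. -/
def expectedReward (m : ℝ) : ℕ → Policy → ℝ → ℝ
  | 0, π, ω => A.reward m ω (π 0 ω)
  | t + 1, π, ω => A.expNext (expectedReward m t fun s => π (s + 1)) ω (π 0 ω)

/-- Expected total discounted reward of the policy `π` from the initial belief state `ω`. -/
def totalReward (β m : ℝ) (π : Policy) (ω : ℝ) : ℝ :=
  ∑' t : ℕ, β ^ t * A.expectedReward m t π ω

/-- The value function: the best expected total discounted reward. -/
def V (β m ω : ℝ) : ℝ := ⨆ π : Policy, A.totalReward β m π ω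

/-- Expected total discounted reward of taking the given action in the first slot and acting
optimally afterwards. -/
def Q (β m ω : ℝ) (u : Action) : ℝ := A.reward m ω u + β * A.expNext (A.V β m) ω u

/-- The passive set under subsidy `m`: the belief states in which the passive action is optimal. -/
def passiveSet (β m : ℝ) : Set ℝ :=
  {ω ∈ Set.Icc (0 : ℝ) 1 | A.Q β m ω .active ≤ A.Q β m ω .passive}

/-- The passive set increases from `∅` to the whole state space `[0, 1]` as the subsidy increases
from `-∞` to `+∞`. -/
def Indexable (β : ℝ) : Prop :=
  Monotone (A.passiveSet β) ∧
  (∀ᶠ m in Filter.atBot, A.passiveSet β m = ∅) ∧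
  (∀ᶠ m in Filter.atTop, A.passiveSet β m = Set.Icc (0 : ℝ) 1)

/-- Whittle's index of the belief state `ω`: the infimum of the subsidies for which the passive
action is optimal at `ω`. For `ω ∈ [0, 1]` the set is nonempty and bounded below as soon as the
arm is indexable. -/
def whittleIndex (β ω : ℝ) : ℝ := sInf {m : ℝ | ω ∈ A.passiveSet β m}

/-! ### The constants -/

/-- The crossing time `L(p01, ω)` as a natural number (meaningful when it is finite). -/
def L (ω : ℝ) : ℕ := (A.crossingTime A.p01 ω).toNat

/-- The common denominator of `C1` and `C2`. -/
def den12 (β ω : ℝ) : ℝ :=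
  (1 - β * A.p11) * (1 - β ^ (A.L ω + 1)) + (1 - β) * β ^ (A.L ω + 1) * A.T^[A.L ω] A.p01

def C1 (β ω : ℝ) : ℝ := (1 - β * A.p11) * (1 - β ^ A.L ω) / A.den12 β ω

def C2 (β ω : ℝ) : ℝ := β ^ A.L ω * A.T^[A.L ω] A.p01 / A.den12 β ω

/-- The common denominator of `C3` and `C4`. -/
def den34 (β : ℝ) : ℝ := 1 + (1 + β) * β * A.p01 - β ^ 2 * A.T A.p11

def C3 (β : ℝ) : ℝ := (1 - β * (1 - A.p01)) / A.den34 β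

def C4 (β : ℝ) : ℝ := (β * A.T A.p11 * (1 - β) + β ^ 2 * A.p01) / A.den34 β

end Arm

end Whittle

end

namespace Whittle.Arm

variable (A : Arm)

/-! ### The belief update -/

/-! Fix the subsidy `m` and study the advantage `gap` of the active over the passive action. The
value function is convex in the belief, being a limit of value iterates; the active value is affine
in it and the passive value convex, so `gap` is concave, with value `-m` at `0` and `B - m` at `1`.
If `gap` vanishes at `ω`, then `m ≤ B`, and concavity forces passivity to be optimal below `ω` and
activity above (`tieAt_of_gap_eq_zero`).

Such a tie turns the Bellman equation into a linear system for the values of the few beliefs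
reachable from `ω`: passive runs either end at a belief at or above `ω`, where the arm is active, or
last forever and are worth `m / (1 - β)`. In each regime the system, whose determinant has to be
shown positive, leaves a single possible `m`; these are the lemmas `TieAt.subsidy_eq_of_*`.

Hence `gap` has at most one zero as a function of `m`. It is continuous in `m`, positive for `m < 0`
and negative for `m > B`, so it changes sign exactly at that zero (`mem_passiveSet_iff`). This gives
indexability and the value of the index together, without a direct proof that `gap` is monotone in
`m`. -/

theorem T_eq (ω : ℝ) : A.T ω = A.p01 + ω * (A.p11 - A.p01) := by
  unfold T; ring

theorem T_mem {ω : ℝ} (h : ω ∈ Set.Icc (0 : ℝ) 1) : A.T ω ∈ Set.Icc (0 : ℝ) 1 := by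
  obtain ⟨h0, h1⟩ := h
  obtain ⟨a0, a1⟩ := A.p01_mem
  obtain ⟨b0, b1⟩ := A.p11_mem
  unfold T
  constructor <;> nlinarith

theorem iterate_T_mem {ω : ℝ} (h : ω ∈ Set.Icc (0 : ℝ) 1) (k : ℕ) :
    A.T^[k] ω ∈ Set.Icc (0 : ℝ) 1 := by
  induction k with
  | zero => exact h
  | succ k ih => rw [Function.iterate_succ_apply']; exact A.T_mem ih

/-- An average of two numbers with weights `ω` and `1 - ω` is bounded by their common bound. -/
theorem abs_average_le {ω x y K : ℝ} (h : ω ∈ Set.Icc (0 : ℝ) 1) (hx : |x| ≤ K) (hy : |y| ≤ K) :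
    |ω * x + (1 - ω) * y| ≤ K := by
  obtain ⟨h0, h1⟩ := h
  rw [abs_le] at *
  constructor <;> nlinarith

/-! ### Value iteration -/

/-- The expected discounted reward of taking the given action and collecting `f` afterwards. -/
noncomputable def backup (β m : ℝ) (f : ℝ → ℝ) (ω : ℝ) (u : Action) : ℝ :=
  A.reward m ω u + β * A.expNext f ω u

/-- The Bellman operator. -/
noncomputable def bellman (β m : ℝ) (f : ℝ → ℝ) (ω : ℝ) : ℝ :=
  max (A.backup β m f ω .passive) (A.backup β m f ω .active)

theorem backup_passive (β m : ℝ) (f : ℝ → ℝ) (ω : ℝ) :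
    A.backup β m f ω .passive = m + β * f (A.T ω) := rfl

theorem backup_active (β m : ℝ) (f : ℝ → ℝ) (ω : ℝ) :
    A.backup β m f ω .active = ω * A.B + β * (ω * f A.p11 + (1 - ω) * f A.p01) := rfl

variable {A} in
theorem abs_reward_le {m ω : ℝ} (h : ω ∈ Set.Icc (0 : ℝ) 1) (u : Action) :
    |A.reward m ω u| ≤ |m| + A.B := by
  have hB := A.B_nonneg
  cases u with
  | passive => simpa [reward] using hB
  | active =>
    have : |ω * A.B| ≤ A.B := by
      rw [abs_of_nonneg (mul_nonneg h.1 hB)]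
      exact mul_le_of_le_one_left hB h.2
    simp only [reward]
    linarith [abs_nonneg m]

variable {A} in
theorem abs_expNext_sub_le {f g : ℝ → ℝ} {K ω : ℝ} (hfg : ∀ x ∈ Set.Icc (0 : ℝ) 1, |f x - g x| ≤ K)
    (h : ω ∈ Set.Icc (0 : ℝ) 1) (u : Action) :
    |A.expNext f ω u - A.expNext g ω u| ≤ K := by
  cases u with
  | passive => exact hfg _ (A.T_mem h)
  | active =>
    have := abs_average_le h (hfg _ A.p11_mem) (hfg _ A.p01_mem)
    simp only [expNext]
    convert this using 2
    ring

variable {A} in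
theorem abs_backup_sub_le {β m m' K ω : ℝ} {f g : ℝ → ℝ} (hβ : 0 ≤ β)
    (hfg : ∀ x ∈ Set.Icc (0 : ℝ) 1, |f x - g x| ≤ K) (h : ω ∈ Set.Icc (0 : ℝ) 1) (u : Action) :
    |A.backup β m f ω u - A.backup β m' g ω u| ≤ |m - m'| + β * K := by
  have h1 : |A.reward m ω u - A.reward m' ω u| ≤ |m - m'| := by
    cases u <;> simp [reward]
  have h2 := mul_le_mul_of_nonneg_left (abs_expNext_sub_le (A := A) hfg h u) hβ
  rw [← abs_of_nonneg hβ, ← abs_mul, abs_of_nonneg hβ] at h2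
  calc |A.backup β m f ω u - A.backup β m' g ω u|
      = |(A.reward m ω u - A.reward m' ω u) +
          β * (A.expNext f ω u - A.expNext g ω u)| := by
        unfold backup; congr 1; ring
    _ ≤ _ := (abs_add_le _ _).trans (add_le_add h1 h2)

variable {A} in
theorem abs_bellman_sub_le {β m m' K ω : ℝ} {f g : ℝ → ℝ} (hβ : 0 ≤ β)
    (hfg : ∀ x ∈ Set.Icc (0 : ℝ) 1, |f x - g x| ≤ K) (h : ω ∈ Set.Icc (0 : ℝ) 1) :
    |A.bellman β m f ω - A.bellman β m' g ω| ≤ |m - m'| + β * K :=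
  (abs_max_sub_max_le_max _ _ _ _).trans
    (max_le (abs_backup_sub_le hβ hfg h _) (abs_backup_sub_le hβ hfg h _))

/-- The value function of the problem with horizon `n`. -/
noncomputable def valueIter (β m : ℝ) : ℕ → ℝ → ℝ
  | 0 => 0
  | n + 1 => A.bellman β m (valueIter β m n)

/-- The passive backup composes `f` with the affine map `T`; the active one is affine in `ω`, since
it uses `f` only at `p11` and `p01`. -/
theorem convexOn_backup {β m : ℝ} {f : ℝ → ℝ} (hβ : 0 ≤ β)
    (hf : ConvexOn ℝ (Set.Icc (0 : ℝ) 1) f) (u : Action) :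
    ConvexOn ℝ (Set.Icc (0 : ℝ) 1) fun ω => A.backup β m f ω u := by
  refine ⟨convex_Icc 0 1, ?_⟩
  intro x hx y hy a b ha hb hab
  obtain rfl : b = 1 - a := by linarith
  cases u with
  | passive =>
    have h := mul_le_mul_of_nonneg_left (hf.2 (A.T_mem hx) (A.T_mem hy) ha hb hab) hβ
    have hT : A.T (a • x + (1 - a) • y) = a • A.T x + (1 - a) • A.T y := by
      simp only [T, smul_eq_mul]; ring
    simp only [backup_passive, hT]
    simp only [smul_eq_mul] at h ⊢
    linarith
  | active =>
    simp only [backup_active, smul_eq_mul]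
    apply le_of_eq
    ring

theorem convexOn_valueIter {β : ℝ} (hβ : 0 ≤ β) (m : ℝ) (n : ℕ) :
    ConvexOn ℝ (Set.Icc (0 : ℝ) 1) (A.valueIter β m n) := by
  induction n with
  | zero => exact convexOn_const 0 (convex_Icc 0 1)
  | succ n ih => exact (A.convexOn_backup hβ ih _).sup (A.convexOn_backup hβ ih _)

theorem abs_valueIter_succ_sub_le {β : ℝ} (hβ : 0 ≤ β) (m : ℝ) (n : ℕ) :
    ∀ ω ∈ Set.Icc (0 : ℝ) 1,
      |A.valueIter β m (n + 1) ω - A.valueIter β m n ω| ≤ (|m| + A.B) * β ^ n := by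
  induction n with
  | zero =>
    intro ω h
    have h1 : ∀ u, |A.backup β m 0 ω u| ≤ |m| + A.B := fun u => by
      have := abs_reward_le (A := A) (m := m) h u
      cases u <;> simpa [backup, expNext] using this
    simp only [valueIter, bellman, Pi.zero_apply, sub_zero, pow_zero, mul_one]
    exact abs_max_le_max_abs_abs.trans (max_le (h1 _) (h1 _))
  | succ n ih =>
    intro ω h
    refine (abs_bellman_sub_le hβ ih h).trans (le_of_eq ?_)
    rw [sub_self, abs_zero]
    ring

theorem abs_valueIter_sub_le {β : ℝ} (hβ : 0 ≤ β) (hβ1 : β < 1) (m m' : ℝ) (n : ℕ) :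
    ∀ ω ∈ Set.Icc (0 : ℝ) 1,
      |A.valueIter β m n ω - A.valueIter β m' n ω| ≤ |m - m'| / (1 - β) := by
  have h1 : 0 < 1 - β := by linarith
  induction n with
  | zero =>
    intro ω _
    simp only [valueIter, sub_self, abs_zero]
    positivity
  | succ n ih =>
    intro ω h
    refine (abs_bellman_sub_le hβ ih h).trans (le_of_eq ?_)
    field_simp
    ring

theorem exists_tendsto_valueIter {β : ℝ} (hβ : 0 ≤ β) (hβ1 : β < 1) (m : ℝ) :
    ∃ v : ℝ → ℝ, ∀ ω ∈ Set.Icc (0 : ℝ) 1,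
      Filter.Tendsto (fun n => A.valueIter β m n ω) Filter.atTop (nhds (v ω)) := by
  have h : ∀ ω : ℝ, ∃ l : ℝ, ω ∈ Set.Icc (0 : ℝ) 1 →
      Filter.Tendsto (fun n => A.valueIter β m n ω) Filter.atTop (nhds l) := by
    intro ω
    by_cases hω : ω ∈ Set.Icc (0 : ℝ) 1
    · have := cauchySeq_of_le_geometric (f := fun n => A.valueIter β m n ω) β (|m| + A.B) hβ1
        (fun n => by
          rw [dist_comm, Real.dist_eq]
          exact A.abs_valueIter_succ_sub_le hβ m n ω hω)
      obtain ⟨l, hl⟩ := cauchySeq_tendsto_of_complete this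
      exact ⟨l, fun _ => hl⟩
    · exact ⟨0, fun h => absurd h hω⟩
  choose v hv using h
  exact ⟨v, hv⟩

theorem abs_valueIter_le {β : ℝ} (hβ : 0 ≤ β) (hβ1 : β < 1) (m : ℝ) (n : ℕ) :
    ∀ ω ∈ Set.Icc (0 : ℝ) 1, |A.valueIter β m n ω| ≤ (|m| + A.B) / (1 - β) := by
  have h1 : 0 < 1 - β := by linarith
  have hB := A.B_nonneg
  induction n with
  | zero =>
    intro ω _
    simp only [valueIter, Pi.zero_apply, abs_zero]
    positivity
  | succ n ih =>
    intro ω h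
    have h2 := abs_bellman_sub_le (A := A) (m := m) (m' := m) (g := 0) hβ
      (by simpa using ih) h
    have h3 := A.abs_valueIter_succ_sub_le hβ m 0 ω h
    simp only [valueIter, sub_self, abs_zero, Pi.zero_apply, sub_zero, pow_zero, mul_one] at h2 h3 ⊢
    have h4 : (|m| + A.B) + (0 + β * ((|m| + A.B) / (1 - β))) = (|m| + A.B) / (1 - β) := by
      field_simp; ring
    have h5 := abs_sub_abs_le_abs_sub (A.bellman β m (A.valueIter β m n) ω) (A.bellman β m 0 ω)
    linarith

/-! ### The verification theorem -/

theorem abs_expectedReward_le (m : ℝ) (t : ℕ) :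
    ∀ π : Policy, ∀ ω ∈ Set.Icc (0 : ℝ) 1, |A.expectedReward m t π ω| ≤ |m| + A.B := by
  induction t with
  | zero => exact fun π ω h => abs_reward_le h _
  | succ t ih =>
    intro π ω h
    rw [expectedReward]
    cases π 0 ω with
    | passive => exact ih _ _ (A.T_mem h)
    | active => exact abs_average_le h (ih _ _ A.p11_mem) (ih _ _ A.p01_mem)

theorem summable_expectedReward {β : ℝ} (hβ : 0 ≤ β) (hβ1 : β < 1) (m : ℝ) (π : Policy) {ω : ℝ}
    (h : ω ∈ Set.Icc (0 : ℝ) 1) : Summable fun t => β ^ t * A.expectedReward m t π ω := by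
  refine Summable.of_norm_bounded (g := fun t => β ^ t * (|m| + A.B))
    ((summable_geometric_of_lt_one hβ hβ1).mul_right _) fun t => ?_
  rw [norm_mul, Real.norm_eq_abs, Real.norm_eq_abs, abs_of_nonneg (pow_nonneg hβ t)]
  exact mul_le_mul_of_nonneg_left (A.abs_expectedReward_le m t π ω h) (pow_nonneg hβ t)

theorem totalReward_eq {β : ℝ} (hβ : 0 ≤ β) (hβ1 : β < 1) (m : ℝ) (π : Policy) {ω : ℝ}
    (h : ω ∈ Set.Icc (0 : ℝ) 1) :
    A.totalReward β m π ω =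
      A.backup β m (A.totalReward β m fun s => π (s + 1)) ω (π 0 ω) := by
  unfold totalReward
  rw [(A.summable_expectedReward hβ hβ1 m π h).tsum_eq_zero_add]
  unfold backup
  simp only [expectedReward, pow_zero, one_mul, add_right_inj]
  cases π 0 ω with
  | passive =>
    simp only [expNext]
    rw [← tsum_mul_left]
    exact tsum_congr fun t => by ring
  | active =>
    simp only [expNext]
    have s1 := A.summable_expectedReward hβ hβ1 m (fun s => π (s + 1)) A.p11_mem
    have s0 := A.summable_expectedReward hβ hβ1 m (fun s => π (s + 1)) A.p01_mem
    rw [← tsum_mul_left, ← tsum_mul_left, ← (s1.mul_left ω).tsum_add (s0.mul_left (1 - ω)),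
      ← tsum_mul_left]
    exact tsum_congr fun t => by ring

theorem abs_totalReward_le {β : ℝ} (hβ : 0 ≤ β) (hβ1 : β < 1) (m : ℝ) (π : Policy) {ω : ℝ}
    (h : ω ∈ Set.Icc (0 : ℝ) 1) : |A.totalReward β m π ω| ≤ (|m| + A.B) / (1 - β) := by
  have hs : HasSum (fun t => β ^ t * (|m| + A.B)) ((1 - β)⁻¹ * (|m| + A.B)) :=
    (hasSum_geometric_of_lt_one hβ hβ1).mul_right _
  have := tsum_of_norm_bounded hs (f := fun t => β ^ t * A.expectedReward m t π ω) fun t => by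
    rw [norm_mul, Real.norm_eq_abs, Real.norm_eq_abs, abs_of_nonneg (pow_nonneg hβ t)]
    exact mul_le_mul_of_nonneg_left (A.abs_expectedReward_le m t π ω h) (pow_nonneg hβ t)
  rw [Real.norm_eq_abs, mul_comm, ← div_eq_mul_inv] at this
  exact this

variable {A} in
theorem backup_le_add {β m K ω : ℝ} {f g : ℝ → ℝ} (hβ : 0 ≤ β)
    (hfg : ∀ x ∈ Set.Icc (0 : ℝ) 1, f x ≤ g x + K) (h : ω ∈ Set.Icc (0 : ℝ) 1) (u : Action) :
    A.backup β m f ω u ≤ A.backup β m g ω u + β * K := by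
  have : A.expNext f ω u ≤ A.expNext g ω u + K := by
    cases u with
    | passive => exact hfg _ (A.T_mem h)
    | active =>
      have h1 := mul_le_mul_of_nonneg_left (hfg _ A.p11_mem) h.1
      have h2 := mul_le_mul_of_nonneg_left (hfg _ A.p01_mem) (sub_nonneg.2 h.2)
      simp only [expNext]
      linarith
  have := mul_le_mul_of_nonneg_left this hβ
  unfold backup
  linarith

theorem le_of_forall_le_add_pow {β x y D : ℝ} (hβ : 0 ≤ β) (hβ1 : β < 1)
    (h : ∀ n : ℕ, x ≤ y + β ^ n * D) : x ≤ y := by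
  have ht : Filter.Tendsto (fun n : ℕ => y + β ^ n * D) Filter.atTop (nhds (y + 0 * D)) :=
    ((tendsto_pow_atTop_nhds_zero_of_lt_one hβ hβ1).mul_const D).const_add y
  rw [zero_mul, add_zero] at ht
  exact ge_of_tendsto' ht h

open Classical in
/-- A bounded solution of the Bellman equation is the value function. -/
theorem V_eq_of_bellman {β : ℝ} (hβ : 0 ≤ β) (hβ1 : β < 1) {m K : ℝ} {f : ℝ → ℝ}
    (hK : ∀ ω ∈ Set.Icc (0 : ℝ) 1, |f ω| ≤ K)
    (hf : ∀ ω ∈ Set.Icc (0 : ℝ) 1, f ω = A.bellman β m f ω) :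
    ∀ ω ∈ Set.Icc (0 : ℝ) 1, A.V β m ω = f ω := by
  -- `D` bounds the distance between `f` and the reward of any policy; each unrolled slot shrinks
  -- the discrepancy by a factor `β`.
  set D := (|m| + A.B) / (1 - β) + K
  have upper : ∀ ω ∈ Set.Icc (0 : ℝ) 1, ∀ π, A.totalReward β m π ω ≤ f ω := by
    intro ω hω π
    refine le_of_forall_le_add_pow (D := D) hβ hβ1 fun n => ?_
    induction n generalizing π ω with
    | zero =>
      have h1 := (abs_le.1 (A.abs_totalReward_le hβ hβ1 m π hω)).2
      have h2 := (abs_le.1 (hK ω hω)).1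
      linarith
    | succ n ih =>
      rw [A.totalReward_eq hβ hβ1 m π hω]
      refine (backup_le_add hβ (fun x hx => ih x hx _) hω _).trans ?_
      have h2 : A.backup β m f ω (π 0 ω) ≤ f ω := by
        rw [hf ω hω]
        cases π 0 ω with
        | passive => exact le_max_left _ _
        | active => exact le_max_right _ _
      rw [pow_succ]
      linarith
  -- The greedy policy for `f`. It is stationary, so its shift by one slot is itself and the
  -- induction hypothesis applies to the continuation.
  set π : Policy := fun _ x =>
    if A.backup β m f x .active ≤ A.backup β m f x .passive then .passive else .active with hπ
  have lower : ∀ ω ∈ Set.Icc (0 : ℝ) 1, f ω ≤ A.totalReward β m π ω := by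
    intro ω hω
    refine le_of_forall_le_add_pow (D := D) hβ hβ1 fun n => ?_
    induction n generalizing ω with
    | zero =>
      have h1 := (abs_le.1 (A.abs_totalReward_le hβ hβ1 m π hω)).1
      have h2 := (abs_le.1 (hK ω hω)).2
      linarith
    | succ n ih =>
      rw [A.totalReward_eq hβ hβ1 m π hω]
      have h2 : f ω = A.backup β m f ω (π 0 ω) := by
        rw [hf ω hω]
        simp only [hπ, bellman]
        split_ifs with h
        · exact max_eq_left h
        · exact max_eq_right (not_le.1 h).le
      rw [h2, pow_succ, mul_comm (β ^ n), mul_assoc]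
      exact backup_le_add hβ (fun x hx => ih x hx) hω _
  intro ω hω
  have : Nonempty Policy := ⟨π⟩
  refine le_antisymm (ciSup_le (upper ω hω)) ((lower ω hω).trans (le_ciSup (f := fun π => A.totalReward β m π ω) ⟨f ω, ?_⟩ π))
  rintro _ ⟨π', rfl⟩
  exact upper ω hω π'

/-- The limit of the iterates is bounded and solves the Bellman equation, so verification identifies
it. Bounds, convexity and Lipschitz dependence on `m` thereby pass from the iterates to `V`. -/
theorem tendsto_valueIter {β : ℝ} (hβ : 0 ≤ β) (hβ1 : β < 1) (m : ℝ) {ω : ℝ}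
    (hω : ω ∈ Set.Icc (0 : ℝ) 1) :
    Filter.Tendsto (fun n => A.valueIter β m n ω) Filter.atTop (nhds (A.V β m ω)) := by
  obtain ⟨v, hv⟩ := A.exists_tendsto_valueIter hβ hβ1 m
  rw [A.V_eq_of_bellman hβ hβ1 (f := v) (K := (|m| + A.B) / (1 - β)) (m := m) _ _ ω hω]
  · exact hv ω hω
  · exact fun x hx => le_of_tendsto' (hv x hx).abs fun n => A.abs_valueIter_le hβ hβ1 m n x hx
  · intro x hx
    refine tendsto_nhds_unique ((Filter.tendsto_add_atTop_iff_nat 1).2 (hv x hx)) ?_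
    refine Filter.Tendsto.max ?_ ?_
    · exact ((hv _ (A.T_mem hx)).const_mul β).const_add m
    · exact ((((hv _ A.p11_mem).const_mul x).add
        ((hv _ A.p01_mem).const_mul (1 - x))).const_mul β).const_add (x * A.B)

/-! ### Properties of the value function -/

theorem V_bellman {β : ℝ} (hβ : 0 ≤ β) (hβ1 : β < 1) (m : ℝ) {ω : ℝ}
    (hω : ω ∈ Set.Icc (0 : ℝ) 1) :
    A.V β m ω = max (A.Q β m ω .passive) (A.Q β m ω .active) := by
  have hv := fun (x : ℝ) (hx : x ∈ Set.Icc (0 : ℝ) 1) => A.tendsto_valueIter hβ hβ1 m hx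
  refine tendsto_nhds_unique ((Filter.tendsto_add_atTop_iff_nat 1).2 (hv ω hω)) ?_
  refine Filter.Tendsto.max ?_ ?_
  · exact ((hv _ (A.T_mem hω)).const_mul β).const_add m
  · exact ((((hv _ A.p11_mem).const_mul ω).add
      ((hv _ A.p01_mem).const_mul (1 - ω))).const_mul β).const_add (ω * A.B)

theorem abs_V_le {β : ℝ} (hβ : 0 ≤ β) (hβ1 : β < 1) (m : ℝ) {ω : ℝ}
    (hω : ω ∈ Set.Icc (0 : ℝ) 1) : |A.V β m ω| ≤ (|m| + A.B) / (1 - β) :=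
  le_of_tendsto' (A.tendsto_valueIter hβ hβ1 m hω).abs
    fun n => A.abs_valueIter_le hβ hβ1 m n ω hω

theorem abs_V_sub_le {β : ℝ} (hβ : 0 ≤ β) (hβ1 : β < 1) (m m' : ℝ) {ω : ℝ}
    (hω : ω ∈ Set.Icc (0 : ℝ) 1) : |A.V β m ω - A.V β m' ω| ≤ |m - m'| / (1 - β) :=
  le_of_tendsto' ((A.tendsto_valueIter hβ hβ1 m hω).sub (A.tendsto_valueIter hβ hβ1 m' hω)).abs
    fun n => A.abs_valueIter_sub_le hβ hβ1 m m' n ω hω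

theorem convexOn_V {β : ℝ} (hβ : 0 ≤ β) (hβ1 : β < 1) (m : ℝ) :
    ConvexOn ℝ (Set.Icc (0 : ℝ) 1) (A.V β m) := by
  refine ⟨convex_Icc 0 1, ?_⟩
  intro x hx y hy a b ha hb hab
  have hz := (convex_Icc (0 : ℝ) 1) hx hy ha hb hab
  exact le_of_tendsto_of_tendsto' (A.tendsto_valueIter hβ hβ1 m hz)
    (((A.tendsto_valueIter hβ hβ1 m hx).const_smul a).add
      ((A.tendsto_valueIter hβ hβ1 m hy).const_smul b))
    fun n => (A.convexOn_valueIter hβ m n).2 hx hy ha hb hab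

theorem continuous_V {β : ℝ} (hβ : 0 ≤ β) (hβ1 : β < 1) {ω : ℝ}
    (hω : ω ∈ Set.Icc (0 : ℝ) 1) : Continuous fun m => A.V β m ω := by
  have h1 : 0 < 1 - β := by linarith
  refine (LipschitzWith.of_dist_le_mul (K := Real.toNNReal (1 - β)⁻¹) fun m m' => ?_).continuous
  rw [Real.dist_eq, Real.dist_eq, Real.coe_toNNReal _ (inv_nonneg.2 h1.le), mul_comm,
    ← div_eq_mul_inv]
  exact A.abs_V_sub_le hβ hβ1 m m' hω

/-- A subsidy of at least `B` beats every active reward, so collecting it forever is optimal. -/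
theorem V_eq_of_B_le {β : ℝ} (hβ : 0 ≤ β) (hβ1 : β < 1) {m : ℝ} (hm : A.B ≤ m) {ω : ℝ}
    (hω : ω ∈ Set.Icc (0 : ℝ) 1) : A.V β m ω = m / (1 - β) := by
  have h1 : 1 - β ≠ 0 := by linarith
  refine A.V_eq_of_bellman hβ hβ1 (f := fun _ => m / (1 - β)) (fun _ _ => le_rfl) ?_ ω hω
  intro x hx
  have h2 : m + β * (m / (1 - β)) = m / (1 - β) := by field_simp; ring
  have h3 : x * A.B ≤ m := (mul_le_of_le_one_left A.B_nonneg hx.2).trans hm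
  rw [bellman, backup_passive, backup_active, max_eq_left, h2]
  linarith

/-! ### The advantage of the active action -/

/-- The advantage of the active over the passive action. -/
noncomputable def gap (β m ω : ℝ) : ℝ := A.Q β m ω .active - A.Q β m ω .passive

theorem Q_passive (β m ω : ℝ) : A.Q β m ω .passive = m + β * A.V β m (A.T ω) := rfl

theorem Q_active (β m ω : ℝ) :
    A.Q β m ω .active = ω * A.B + β * (ω * A.V β m A.p11 + (1 - ω) * A.V β m A.p01) := rfl

theorem gap_eq (β m ω : ℝ) :
    A.gap β m ω = ω * A.B + β * (ω * A.V β m A.p11 + (1 - ω) * A.V β m A.p01) -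
      (m + β * A.V β m (A.T ω)) := rfl

/-- When the state is known, observing it tells nothing: both actions lead to the same belief and
the continuations cancel. -/
theorem gap_zero (β m : ℝ) : A.gap β m 0 = -m := by
  have : A.T 0 = A.p01 := by simp [T]
  rw [gap_eq, this]; ring

theorem gap_one (β m : ℝ) : A.gap β m 1 = A.B - m := by
  have : A.T 1 = A.p11 := by simp [T]
  rw [gap_eq, this]; ring

theorem concaveOn_gap {β : ℝ} (hβ : 0 ≤ β) (hβ1 : β < 1) (m : ℝ) :
    ConcaveOn ℝ (Set.Icc (0 : ℝ) 1) (A.gap β m) := by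
  refine ⟨convex_Icc 0 1, ?_⟩
  intro x hx y hy a b ha hb hab
  have h := (A.convexOn_backup (m := m) hβ (A.convexOn_V hβ hβ1 m) .passive).2 hx hy ha hb hab
  obtain rfl : b = 1 - a := by linarith
  simp only [backup_passive, gap_eq, smul_eq_mul] at h ⊢
  linarith

theorem continuous_gap {β : ℝ} (hβ : 0 ≤ β) (hβ1 : β < 1) {ω : ℝ}
    (hω : ω ∈ Set.Icc (0 : ℝ) 1) : Continuous fun m => A.gap β m ω := by
  have h1 := A.continuous_V hβ hβ1 A.p11_mem
  have h0 := A.continuous_V hβ hβ1 A.p01_mem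
  have hT := A.continuous_V hβ hβ1 (A.T_mem hω)
  simp only [gap_eq]
  fun_prop

theorem mem_passiveSet {β m ω : ℝ} (hω : ω ∈ Set.Icc (0 : ℝ) 1) :
    ω ∈ A.passiveSet β m ↔ A.gap β m ω ≤ 0 := by
  simp only [passiveSet, Set.mem_ofPred_eq, hω, true_and, gap, sub_nonpos]

theorem gap_of_B_le {β : ℝ} (hβ : 0 ≤ β) (hβ1 : β < 1) {m : ℝ} (hm : A.B ≤ m) {ω : ℝ}
    (hω : ω ∈ Set.Icc (0 : ℝ) 1) : A.gap β m ω = ω * A.B - m := by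
  rw [gap_eq, A.V_eq_of_B_le hβ hβ1 hm A.p11_mem, A.V_eq_of_B_le hβ hβ1 hm A.p01_mem,
    A.V_eq_of_B_le hβ hβ1 hm (A.T_mem hω)]
  ring

theorem gap_neg_of_B_lt {β : ℝ} (hβ : 0 ≤ β) (hβ1 : β < 1) {m : ℝ} (hm : A.B < m) {ω : ℝ}
    (hω : ω ∈ Set.Icc (0 : ℝ) 1) : A.gap β m ω < 0 := by
  rw [A.gap_of_B_le hβ hβ1 hm.le hω]
  have := mul_le_of_le_one_left A.B_nonneg hω.2
  linarith

/-- A concave function lies above its chord, here `ω B - m`. -/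
theorem gap_pos_of_neg {β : ℝ} (hβ : 0 ≤ β) (hβ1 : β < 1) {m : ℝ} (hm : m < 0) {ω : ℝ}
    (hω : ω ∈ Set.Icc (0 : ℝ) 1) : 0 < A.gap β m ω := by
  have h := (A.concaveOn_gap hβ hβ1 m).2 (Set.left_mem_Icc.2 zero_le_one)
    (Set.right_mem_Icc.2 zero_le_one) (sub_nonneg.2 hω.2) hω.1 (by ring)
  rw [gap_zero, gap_one] at h
  simp only [smul_eq_mul, mul_zero, mul_one, zero_add] at h
  nlinarith [mul_nonneg hω.1 A.B_nonneg]

/-- The policy with threshold `ω` is optimal under the subsidy `m`, with either action at `ω`. -/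
structure TieAt (β m ω : ℝ) : Prop where
  passive : ∀ y ∈ Set.Icc (0 : ℝ) 1, y ≤ ω → A.V β m y = m + β * A.V β m (A.T y)
  active : ∀ y ∈ Set.Icc (0 : ℝ) 1, ω ≤ y →
    A.V β m y = y * A.B + β * (y * A.V β m A.p11 + (1 - y) * A.V β m A.p01)

/-- Concavity and `gap ≥ 0` at `1` make the sign of `gap` change at most once, from negative to
positive. -/
theorem tieAt_of_gap_eq_zero {β : ℝ} (hβ : 0 ≤ β) (hβ1 : β < 1) {m ω : ℝ}
    (hω : ω ∈ Set.Icc (0 : ℝ) 1) (h0 : A.gap β m ω = 0) : A.TieAt β m ω := by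
  have passive_of : ∀ y ∈ Set.Icc (0 : ℝ) 1, A.gap β m y ≤ 0 →
      A.V β m y = m + β * A.V β m (A.T y) := fun y hy h => by
    rw [A.V_bellman hβ hβ1 m hy, max_eq_left (sub_nonpos.1 h), Q_passive]
  have active_of : ∀ y ∈ Set.Icc (0 : ℝ) 1, 0 ≤ A.gap β m y →
      A.V β m y = y * A.B + β * (y * A.V β m A.p11 + (1 - y) * A.V β m A.p01) := fun y hy h => by
    rw [A.V_bellman hβ hβ1 m hy, max_eq_right (sub_nonneg.1 h), Q_active]
  have hm : m ≤ A.B := not_lt.1 fun h => (A.gap_neg_of_B_lt hβ hβ1 h hω).ne h0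
  have h1 : 0 ≤ A.gap β m 1 := by rw [gap_one]; linarith
  have conc := A.concaveOn_gap hβ hβ1 m
  have mem1 : (1 : ℝ) ∈ Set.Icc (0 : ℝ) 1 := ⟨zero_le_one, le_rfl⟩
  -- a point `t` of `[x, 1]` inherits a share of the advantage at `x`
  have share : ∀ x ∈ Set.Icc (0 : ℝ) 1, ∀ t, x ≤ t → t < 1 →
      (1 - t) * A.gap β m x ≤ (1 - x) * A.gap β m t := by
    intro x hx t hxt ht
    have hx1 : 0 < 1 - x := by linarith
    have := conc.2 hx mem1 (div_nonneg (sub_nonneg.2 ht.le) hx1.le)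
      (div_nonneg (sub_nonneg.2 hxt) hx1.le) (by field_simp; ring)
    have e : ((1 - t) / (1 - x)) • x + ((t - x) / (1 - x)) • (1 : ℝ) = t := by
      simp only [smul_eq_mul]; field_simp; ring
    rw [e] at this
    simp only [smul_eq_mul] at this
    have h2 : 0 ≤ (t - x) / (1 - x) * A.gap β m 1 :=
      mul_nonneg (div_nonneg (by linarith) hx1.le) h1
    have h3 : (1 - t) / (1 - x) * A.gap β m x ≤ A.gap β m t := by linarith
    rwa [div_mul_eq_mul_div, div_le_iff₀ hx1, mul_comm (A.gap β m t)] at h3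
  constructor
  · intro y hy hyω
    apply passive_of y hy
    rcases hω.2.lt_or_eq with hlt | rfl
    · have := share y hy ω hyω hlt
      rw [h0, mul_zero] at this
      exact nonpos_of_mul_nonpos_right this (by linarith)
    -- At `ω = 1` the chord argument degenerates, but the tie forces `m = B`, where `gap` is
    -- explicit.
    · rw [gap_one] at h0
      rw [A.gap_of_B_le hβ hβ1 (by linarith) hy]
      have := mul_le_of_le_one_left A.B_nonneg hy.2
      linarith
  · intro y hy hωy
    apply active_of y hy
    rcases hy.2.lt_or_eq with hlt | rfl
    · have := share ω hω y hωy hlt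
      rw [h0, mul_zero] at this
      exact nonneg_of_mul_nonneg_right this (by linarith)
    · exact h1

/-- A sign of `gap` on the wrong side of `w` would, by the intermediate value theorem, produce a
zero in `m` other than `w`. -/
theorem mem_passiveSet_iff {β : ℝ} (hβ : 0 ≤ β) (hβ1 : β < 1) {ω w : ℝ}
    (hω : ω ∈ Set.Icc (0 : ℝ) 1) (hw : ∀ m, A.TieAt β m ω → m = w) (m : ℝ) :
    ω ∈ A.passiveSet β m ↔ w ≤ m := by
  have hw' : ∀ m, A.gap β m ω = 0 → m = w := fun m h => hw m (A.tieAt_of_gap_eq_zero hβ hβ1 hω h)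
  have cont := A.continuous_gap hβ hβ1 hω
  rw [A.mem_passiveSet hω]
  constructor
  · intro h
    have hlt : min m 0 - 1 < 0 := by linarith [min_le_right m 0]
    have hle : min m 0 - 1 ≤ m := by linarith [min_le_left m 0]
    obtain ⟨m', hm', h0⟩ := intermediate_value_Icc' hle cont.continuousOn
      ⟨h, (A.gap_pos_of_neg hβ hβ1 hlt hω).le⟩
    rw [← hw' m' h0]
    exact hm'.2
  · intro h
    by_contra! hpos
    have hlt : A.B < max m A.B + 1 := by linarith [le_max_right m A.B]
    have hle : m ≤ max m A.B + 1 := by linarith [le_max_left m A.B]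
    obtain ⟨m', hm', h0⟩ := intermediate_value_Icc' hle cont.continuousOn
      ⟨(A.gap_neg_of_B_lt hβ hβ1 hlt hω).le, hpos.le⟩
    have : m' = m := le_antisymm ((hw' m' h0).le.trans h) hm'.1
    exact hpos.ne' (this ▸ h0)

theorem whittleIndex_eq {β : ℝ} (hβ : 0 ≤ β) (hβ1 : β < 1) {ω w : ℝ}
    (hω : ω ∈ Set.Icc (0 : ℝ) 1) (hw : ∀ m, A.TieAt β m ω → m = w) :
    A.whittleIndex β ω = w := by
  have : {m : ℝ | ω ∈ A.passiveSet β m} = Set.Ici w :=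
    Set.ext fun m => A.mem_passiveSet_iff hβ hβ1 hω hw m
  rw [whittleIndex, this, csInf_Ici]

theorem indexable_of_forall_exists {β : ℝ} (hβ : 0 ≤ β) (hβ1 : β < 1)
    (h : ∀ ω ∈ Set.Icc (0 : ℝ) 1, ∃ w, ∀ m, A.TieAt β m ω → m = w) : A.Indexable β := by
  refine ⟨?_, ?_, ?_⟩
  · intro m m' hm ω hω
    obtain ⟨w, hw⟩ := h ω hω.1
    have iff := A.mem_passiveSet_iff hβ hβ1 hω.1 hw
    exact (iff m').2 (((iff m).1 hω).trans hm)
  · filter_upwards [Filter.eventually_lt_atBot 0] with m hm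
    refine Set.eq_empty_of_forall_notMem fun ω hω => ?_
    exact ((A.mem_passiveSet hω.1).1 hω).not_gt (A.gap_pos_of_neg hβ hβ1 hm hω.1)
  · filter_upwards [Filter.eventually_gt_atTop A.B] with m hm
    refine Set.Subset.antisymm (fun ω hω => hω.1) fun ω hω => ?_
    exact (A.mem_passiveSet hω).2 (A.gap_neg_of_B_lt hβ hβ1 hm hω).le

/-! ### Passive runs -/

theorem V_of_passive_run {β m y : ℝ} (n : ℕ)
    (h : ∀ k < n, A.V β m (A.T^[k] y) = m + β * A.V β m (A.T (A.T^[k] y))) :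
    (1 - β) * A.V β m y = m * (1 - β ^ n) + (1 - β) * β ^ n * A.V β m (A.T^[n] y) := by
  induction n with
  | zero => simp
  | succ n ih =>
    rw [ih fun k hk => h k (hk.trans n.lt_succ_self), h n n.lt_succ_self,
      Function.iterate_succ_apply']
    ring

/-- By `V_of_passive_run`, the deviation from `m` is `β ^ n` times a bounded quantity for every `n`.
-/
theorem V_of_passive_forever {β : ℝ} (hβ : 0 ≤ β) (hβ1 : β < 1) {m : ℝ} {s : Set ℝ}
    (hs : s ⊆ Set.Icc (0 : ℝ) 1) (hT : Set.MapsTo A.T s s)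
    (h : ∀ y ∈ s, A.V β m y = m + β * A.V β m (A.T y)) {y : ℝ} (hy : y ∈ s) :
    (1 - β) * A.V β m y = m := by
  have hk : ∀ k, A.T^[k] y ∈ s := fun k => hT.iterate k hy
  have h1 : ∀ n : ℕ, |(1 - β) * A.V β m y - m| ≤
      0 + β ^ n * (|m| + (|m| + A.B)) := by
    intro n
    have hn := A.V_of_passive_run n fun k _ => h _ (hk k)
    have hb := A.abs_V_le hβ hβ1 m (hs (hk n))
    rw [le_div_iff₀ (by linarith)] at hb
    have e : (1 - β) * A.V β m y - m = β ^ n * (-m + A.V β m (A.T^[n] y) * (1 - β)) := by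
      rw [hn]; ring
    rw [e, abs_mul, abs_of_nonneg (pow_nonneg hβ n), zero_add]
    refine mul_le_mul_of_nonneg_left ((abs_add_le _ _).trans ?_) (pow_nonneg hβ n)
    rw [abs_neg, abs_mul, abs_of_pos (show 0 < 1 - β by linarith)]
    linarith
  have := le_of_forall_le_add_pow hβ hβ1 h1
  exact sub_eq_zero.1 (abs_nonpos_iff.1 this)

variable {A} in
/-- At a tie, a belief state from which the passive arm never exceeds the threshold is worth the
discounted subsidies. -/
theorem TieAt.V_of_mapsTo {β : ℝ} (hβ : 0 ≤ β) (hβ1 : β < 1) {m ω a b : ℝ} (h : A.TieAt β m ω)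
    (ha : 0 ≤ a) (hb : b ≤ ω) (hω : ω ≤ 1) (hT : Set.MapsTo A.T (Set.Icc a b) (Set.Icc a b))
    {y : ℝ} (hy : y ∈ Set.Icc a b) : (1 - β) * A.V β m y = m := by
  have hs : Set.Icc a b ⊆ Set.Icc (0 : ℝ) 1 := Set.Icc_subset_Icc ha (hb.trans hω)
  exact A.V_of_passive_forever hβ hβ1 hs hT
    (fun x hx => h.passive x (hs hx) (hx.2.trans hb)) hy

/-! ### Ties in the two regimes -/

theorem T_mem_Icc_min_max {ω : ℝ} (hω : ω ∈ Set.Icc (0 : ℝ) 1) :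
    A.T ω ∈ Set.Icc (min A.p01 A.p11) (max A.p01 A.p11) := by
  obtain ⟨h0, h1⟩ := hω
  have a1 := min_le_left A.p01 A.p11
  have a2 := min_le_right A.p01 A.p11
  have b1 := le_max_left A.p01 A.p11
  have b2 := le_max_right A.p01 A.p11
  unfold T
  constructor <;> nlinarith

/-- The tie equation `V ω = V ω` between the two actions. -/
theorem TieAt.eq {A : Arm} {β m ω : ℝ} (h : A.TieAt β m ω) (hω : ω ∈ Set.Icc (0 : ℝ) 1) :
    m + β * A.V β m (A.T ω) =
      ω * A.B + β * (ω * A.V β m A.p11 + (1 - ω) * A.V β m A.p01) :=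
  (h.passive ω hω le_rfl).symm.trans (h.active ω hω le_rfl)

/-- Here `T ω`, `p11` and `p01` are all active. The active value is affine and `T ω` is the average
of `p11` and `p01`, so both continuations are equal and only the immediate rewards count. -/
theorem TieAt.subsidy_eq_of_le {A : Arm} {β m ω : ℝ} (h : A.TieAt β m ω)
    (hω : ω ∈ Set.Icc (0 : ℝ) 1) (h0 : ω ≤ A.p01) (h1 : ω ≤ A.p11) : m = ω * A.B := by
  have e := h.eq hω
  have hT := h.active _ (A.T_mem hω) ((le_min h0 h1).trans (A.T_mem_Icc_min_max hω).1)
  have e1 := h.active _ A.p11_mem h1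
  have e0 := h.active _ A.p01_mem h0
  rw [T] at e hT
  linear_combination e - β * hT + β * ω * e1 + β * (1 - ω) * e0

/-- The interval `[0, ω]` is invariant under `T` and contains `p01` and `p11`, so every continuation
is worth `m / (1 - β)`. -/
theorem TieAt.subsidy_eq_of_ge {A : Arm} {β m ω : ℝ} (hβ : 0 ≤ β) (hβ1 : β < 1)
    (h : A.TieAt β m ω) (hω : ω ∈ Set.Icc (0 : ℝ) 1) (h0 : A.p01 ≤ ω) (h1 : A.p11 ≤ ω) :
    m = ω * A.B := by
  have hV : ∀ y ∈ Set.Icc 0 ω, (1 - β) * A.V β m y = m := fun y hy =>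
    h.V_of_mapsTo hβ hβ1 le_rfl le_rfl hω.2 (fun x hx =>
      have hx' : x ∈ Set.Icc (0 : ℝ) 1 := ⟨hx.1, hx.2.trans hω.2⟩
      ⟨(A.T_mem hx').1, (A.T_mem_Icc_min_max hx').2.trans (max_le h0 h1)⟩) hy
  have hT := hV (A.T ω) ⟨(A.T_mem hω).1, (A.T_mem_Icc_min_max hω).2.trans (max_le h0 h1)⟩
  have e1 := hV _ ⟨A.p11_mem.1, h1⟩
  have e0 := hV _ ⟨A.p01_mem.1, h0⟩
  have h1β : 1 - β ≠ 0 := by linarith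
  apply mul_left_cancel₀ h1β
  linear_combination (1 - β) * h.eq hω - β * hT + β * ω * e1 + β * (1 - ω) * e0

theorem ωo_eq : A.ωo = A.p01 / (1 - (A.p11 - A.p01)) := by
  unfold ωo p10
  congr 1
  ring

/-- If the transition matrix is not the identity, the stationary probability is a fixed point. -/
theorem T_sub_self (h : A.p11 - A.p01 < 1) (ω : ℝ) :
    A.T ω - ω = (A.ωo - ω) * (1 - (A.p11 - A.p01)) := by
  have : 1 - (A.p11 - A.p01) ≠ 0 := by linarith
  rw [ωo_eq, T_eq]
  field_simp
  ring

theorem sub_lt_one_or : A.p11 - A.p01 < 1 ∨ (A.p01 = 0 ∧ A.p11 = 1) := by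
  obtain ⟨a0, a1⟩ := A.p01_mem
  obtain ⟨b0, b1⟩ := A.p11_mem
  rcases (show A.p11 - A.p01 ≤ 1 by linarith).lt_or_eq with h | h
  · exact Or.inl h
  · exact Or.inr ⟨by linarith, by linarith⟩

theorem T_le_self {ω : ℝ} (h : A.ωo ≤ ω) : A.T ω ≤ ω := by
  rcases A.sub_lt_one_or with h1 | ⟨h0, h1⟩
  · have := A.T_sub_self h1 ω
    nlinarith
  · simp [T, h0, h1]

theorem self_lt_T {ω : ℝ} (hω : 0 ≤ ω) (h : ω < A.ωo) : ω < A.T ω := by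
  rcases A.sub_lt_one_or with h1 | ⟨h0, h1⟩
  · have := A.T_sub_self h1 ω
    nlinarith
  -- For the identity matrix `ωo = 0`, so no `ω ≥ 0` lies below it.
  · simp only [ωo_eq, h0, zero_div] at h
    linarith

/-! ### Positively correlated channels -/

section Positive

variable {A}

theorem one_sub_mul_pos {β x : ℝ} (hβ : 0 ≤ β) (hβ1 : β < 1) (hx : x ≤ 1) : 0 < 1 - β * x := by
  nlinarith

/-- Since `T` is increasing and `T ω ≤ ω`, passivity never leaves `[0, ω]`, which contains `p01` and
`T ω`; only `p11` is active. -/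
theorem TieAt.subsidy_eq_of_ωo_le {β m ω : ℝ} (hβ : 0 ≤ β) (hβ1 : β < 1)
    (h : A.TieAt β m ω) (hω : ω ∈ Set.Icc (0 : ℝ) 1) (hA : A.p01 ≤ A.p11) (ho : A.ωo ≤ ω)
    (h1 : ω < A.p11) : m = ω / (1 - β * A.p11 + β * ω) * A.B := by
  have hTω := A.T_le_self ho
  have hT0 := (A.T_mem hω).1
  have h0 : A.p01 ≤ ω := by
    refine le_trans ?_ hTω
    have := (A.T_mem_Icc_min_max hω).1
    rwa [min_eq_left hA] at this
  have hV : ∀ y ∈ Set.Icc 0 ω, (1 - β) * A.V β m y = m := fun y hy =>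
    h.V_of_mapsTo hβ hβ1 le_rfl le_rfl hω.2 (fun x hx =>
      ⟨(A.T_mem ⟨hx.1, hx.2.trans hω.2⟩).1, by
        refine le_trans ?_ hTω
        rw [T_eq, T_eq]
        nlinarith [hx.2]⟩) hy
  have hT := hV (A.T ω) ⟨hT0, hTω⟩
  have e0 := hV _ ⟨A.p01_mem.1, h0⟩
  have e1 := h.active _ A.p11_mem h1.le
  have e := h.eq hω
  have h1β : 1 - β ≠ 0 := by linarith
  have hN := one_sub_mul_pos hβ hβ1 A.p11_mem.2
  have hd : 0 < 1 - β * A.p11 + β * ω := by nlinarith [mul_nonneg hβ hω.1]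
  rw [div_mul_eq_mul_div, eq_div_iff hd.ne']
  apply mul_left_cancel₀ h1β
  generalize A.V β m A.p11 = a at *
  generalize A.V β m A.p01 = b at *
  generalize A.V β m (A.T ω) = c at *
  linear_combination (1 - β) * (1 - β * A.p11) * e - β * (1 - β * A.p11) * hT
    + β * ω * (1 - β) * e1 + (β * (1 - ω) * (1 - β * A.p11) + β * ω * β * (1 - A.p11)) * e0

/-- Below `ω`, the passive belief moves up by at least the drift `T ω - ω`. -/
theorem mul_drift_le_iterate {ω : ℝ} (hω : 0 ≤ ω) (n : ℕ)
    (h : ∀ k < n, A.T^[k] A.p01 ≤ ω) : (n + 1) * (A.T ω - ω) ≤ A.T^[n] A.p01 := by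
  have hρ : A.p11 - A.p01 ≤ 1 := by linarith [A.p11_mem.2, A.p01_mem.1]
  induction n with
  | zero =>
    -- `p01` is the drift at `0`, which already counts as one step; hence the factor `n + 1`.
    simp only [Function.iterate_zero, id, T_eq]
    push_cast
    nlinarith
  | succ n ih =>
    have h1 := ih fun k hk => h k (hk.trans n.lt_succ_self)
    have h2 := h n n.lt_succ_self
    rw [Function.iterate_succ_apply']
    generalize A.T^[n] A.p01 = x at *
    -- The slope of `T` is at most `1`, so the drift is nonincreasing in the belief.
    have h3 : A.T ω - ω ≤ A.T x - x := by
      rw [T_eq, T_eq]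
      nlinarith
    push_cast
    linarith

theorem exists_lt_iterate {ω : ℝ} (hω : 0 ≤ ω) (ho : ω < A.ωo) :
    ∃ k, ω < A.T^[k] A.p01 := by
  by_contra! hk
  obtain ⟨n, hn⟩ := exists_nat_gt (ω / (A.T ω - ω))
  have hd : 0 < A.T ω - ω := sub_pos.2 (A.self_lt_T hω ho)
  rw [div_lt_iff₀ hd] at hn
  have := mul_drift_le_iterate hω n fun k _ => hk k
  have := hk n
  linarith

theorem crossingTime_spec {ω : ℝ} (h : ∃ k, ω < A.T^[k] A.p01) :
    A.crossingTime A.p01 ω ≠ ⊤ ∧ ω < A.T^[A.L ω] A.p01 ∧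
      ∀ k < A.L ω, A.T^[k] A.p01 ≤ ω := by
  have hne : ((fun k : ℕ => (k : ℕ∞)) '' {k : ℕ | ω < A.T^[k] A.p01}).Nonempty := Set.Nonempty.image _ h
  obtain ⟨l, hl, hl'⟩ := csInf_mem hne
  have hc : A.crossingTime A.p01 ω = l := hl'.symm
  have hL : A.L ω = l := by rw [L, hc, ENat.toNat_natCast]
  refine ⟨by simp [hc], hL ▸ hl, fun k hk => ?_⟩
  by_contra! hlt
  have : A.crossingTime A.p01 ω ≤ (k : ℕ∞) := sInf_le ⟨k, hlt, rfl⟩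
  rw [hc, Nat.cast_le] at this
  omega

theorem den12_pos {β : ℝ} (hβ : 0 ≤ β) (hβ1 : β < 1) (ω : ℝ) : 0 < A.den12 β ω := by
  have hN := one_sub_mul_pos hβ hβ1 A.p11_mem.2
  have h1 : 0 < 1 - β ^ (A.L ω + 1) := sub_pos.2 (pow_lt_one₀ hβ hβ1 (Nat.succ_ne_zero _))
  have ht := (A.iterate_T_mem A.p01_mem (A.L ω)).1
  have h2 : 0 ≤ (1 - β) * β ^ (A.L ω + 1) * A.T^[A.L ω] A.p01 :=
    mul_nonneg (mul_nonneg (by linarith) (pow_nonneg hβ _)) ht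
  unfold den12
  linarith [mul_pos hN h1]

/-- The delicate term is `ω - β T ω = (1 - β) ω - β (T ω - ω)`, which may be negative. Bernoulli
gives `1 - β ^ L ≤ L (1 - β)`, and the drift bound gives `L (T ω - ω) ≤ ω`. What then remains is at
least `(1 - β) (1 - β p11) + β (1 - β) ^ 2 ω`. -/
theorem index_den_pos {β ω : ℝ} (hβ : 0 ≤ β) (hβ1 : β < 1) (hω : 0 ≤ ω) (ho : ω < A.ωo) :
    0 < 1 - β * A.p11 - A.C1 β ω * (β * (1 - β * A.p11) - β * (ω - β * A.T ω)) := by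
  obtain ⟨-, ht, hL⟩ := crossingTime_spec (exists_lt_iterate hω ho)
  have hD := den12_pos (A := A) hβ hβ1 ω
  have hN := one_sub_mul_pos hβ hβ1 A.p11_mem.2
  have hd : 0 < A.T ω - ω := sub_pos.2 (A.self_lt_T hω ho)
  have e : 1 - β * A.p11 - A.C1 β ω * (β * (1 - β * A.p11) - β * (ω - β * A.T ω)) =
      (1 - β * A.p11) * ((1 - β) * (1 - β * A.p11)
        + (1 - β) * β ^ (A.L ω + 1) * A.T^[A.L ω] A.p01
        + β * (1 - β ^ A.L ω) * (ω - β * A.T ω)) / A.den12 β ω := by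
    rw [C1, eq_div_iff hD.ne', sub_mul, mul_right_comm, div_mul_cancel₀ _ hD.ne', den12]
    ring
  rw [e]
  refine div_pos (mul_pos hN ?_) hD
  have drift : (A.L ω : ℝ) * (A.T ω - ω) ≤ ω := by
    rcases hl : A.L ω with _ | n
    · simpa using hω
    · rw [hl] at hL
      have := mul_drift_le_iterate hω n fun k hk => hL k (hk.trans n.lt_succ_self)
      push_cast
      exact this.trans (hL n n.lt_succ_self)
  have bern : 1 - β ^ A.L ω ≤ A.L ω * (1 - β) := by
    have := one_add_mul_le_pow (a := β - 1) (by linarith) (A.L ω)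
    rw [add_sub_cancel] at this
    linarith
  have hp : 0 ≤ β ^ A.L ω := pow_nonneg hβ _
  have h1β : 0 < 1 - β := by linarith
  have i1 : (1 - β ^ A.L ω) * (A.T ω - ω) ≤ (1 - β) * ω :=
    calc _ ≤ A.L ω * (1 - β) * (A.T ω - ω) := mul_le_mul_of_nonneg_right bern hd.le
      _ = (1 - β) * (A.L ω * (A.T ω - ω)) := by ring
      _ ≤ _ := mul_le_mul_of_nonneg_left drift h1β.le
  have i2 : β ^ 2 * ((1 - β ^ A.L ω) * (A.T ω - ω)) ≤ β ^ 2 * ((1 - β) * ω) :=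
    mul_le_mul_of_nonneg_left i1 (sq_nonneg β)
  have i3 : (1 - β) * β ^ (A.L ω + 1) * ω ≤ (1 - β) * β ^ (A.L ω + 1) * A.T^[A.L ω] A.p01 :=
    mul_le_mul_of_nonneg_left ht.le (mul_nonneg h1β.le (pow_nonneg hβ _))
  have i4 : 0 < (1 - β) * (1 - β * A.p11) := mul_pos h1β hN
  have i5 : 0 ≤ β * (1 - β) * (1 - β) * ω :=
    mul_nonneg (mul_nonneg (mul_nonneg hβ h1β.le) h1β.le) hω
  rw [pow_succ] at i3 ⊢
  linarith

/-- `T ω` and `p11` are active; the run from `p01` is passive for `L` slots and then active at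
`T^[L] p01`, which closes the system. -/
theorem TieAt.subsidy_eq_of_lt_ωo {β m ω : ℝ} (hβ : 0 ≤ β) (hβ1 : β < 1)
    (h : A.TieAt β m ω) (hω : ω ∈ Set.Icc (0 : ℝ) 1) (hA : A.p01 ≤ A.p11)
    (ho : ω < A.ωo) :
    m = (ω - β * A.T ω
          + A.C2 β ω * (1 - β) * (β * (1 - β * A.p11) - β * (ω - β * A.T ω)))
        / (1 - β * A.p11
          - A.C1 β ω * (β * (1 - β * A.p11) - β * (ω - β * A.T ω))) * A.B := by
  obtain ⟨-, ht, hL⟩ := crossingTime_spec (exists_lt_iterate hω.1 ho)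
  have hD := den12_pos (A := A) hβ hβ1 ω
  have hN := one_sub_mul_pos hβ hβ1 A.p11_mem.2
  have hTω := A.self_lt_T hω.1 ho
  have h1 : ω ≤ A.p11 := by
    refine hTω.le.trans ?_
    have := (A.T_mem_Icc_min_max hω).2
    rwa [max_eq_right hA] at this
  have e := h.eq hω
  have eT := h.active _ (A.T_mem hω) hTω.le
  have e1 := h.active _ A.p11_mem h1
  have et := h.active _ (A.iterate_T_mem A.p01_mem _) ht.le
  have e0 := A.V_of_passive_run (A.L ω) fun k hk =>
    h.passive _ (A.iterate_T_mem A.p01_mem k) (hL k hk)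
  -- the value of `p01`, as in the definition of `C1` and `C2`
  have hb : (1 - β) * A.V β m A.p01 = A.C1 β ω * m + (1 - β) * (A.C2 β ω * A.B) := by
    have : (1 - β) * A.V β m A.p01 * A.den12 β ω =
        (1 - β * A.p11) * (1 - β ^ A.L ω) * m
          + (1 - β) * (β ^ A.L ω * A.T^[A.L ω] A.p01) * A.B := by
      rw [den12]
      rw [et] at e0
      generalize A.V β m A.p01 = b at *
      generalize A.V β m A.p11 = a at *
      generalize A.T^[A.L ω] A.p01 = t at *
      linear_combination (1 - β * A.p11) * e0 + (1 - β) * β ^ (A.L ω) * β * t * e1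
    rw [C1, C2]
    field_simp
    linear_combination this
  rw [div_mul_eq_mul_div, eq_div_iff (index_den_pos hβ hβ1 hω.1 ho).ne']
  generalize A.V β m A.p01 = b at *
  generalize A.V β m A.p11 = a at *
  generalize A.V β m (A.T ω) = c at *
  generalize A.C1 β ω = c1 at *
  generalize A.C2 β ω = c2 at *
  generalize A.T ω = x at *
  linear_combination (1 - β * A.p11) * e - β * (1 - β * A.p11) * eT
    + (β * ω - β * β * x) * e1 + β * (1 - β * A.p11 - (ω - β * x)) * hb

end Positive

/-! ### Negatively correlated channels -/

section Negative

variable {A}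

theorem T_antitone (hA : A.p11 < A.p01) : Antitone A.T := by
  intro x y hxy
  rw [T_eq, T_eq]
  nlinarith

theorem one_sub_mul_one_sub_p01_pos {β : ℝ} (hβ : 0 ≤ β) (hβ1 : β < 1) :
    0 < 1 - β * (1 - A.p01) :=
  one_sub_mul_pos hβ hβ1 (by linarith [A.p01_mem.1])

theorem T_mem_Icc (hA : A.p11 < A.p01) {ω : ℝ} (hω : ω ∈ Set.Icc (0 : ℝ) 1) :
    A.T ω ∈ Set.Icc A.p11 A.p01 := by
  have := A.T_mem_Icc_min_max hω
  rwa [min_eq_right hA.le, max_eq_left hA.le] at this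

theorem den34_pos {β : ℝ} (hβ : 0 ≤ β) (hA : A.p11 < A.p01) :
    0 < A.den34 β := by
  have h1 := (T_mem_Icc hA A.p11_mem).2
  have h2 := mul_le_mul_of_nonneg_left h1 (sq_nonneg β)
  have h3 := mul_nonneg hβ A.p01_mem.1
  unfold den34
  linarith

theorem T_ωo (hA : A.p11 < A.p01) : A.T A.ωo = A.ωo := by
  have := A.T_sub_self (by linarith) A.ωo
  rw [sub_self, zero_mul] at this
  linarith

theorem ωo_mem (hA : A.p11 < A.p01) : A.ωo ∈ Set.Icc A.p11 A.p01 := by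
  have h1 : 0 < 1 - (A.p11 - A.p01) := by linarith
  obtain ⟨a0, a1⟩ := A.p01_mem
  obtain ⟨b0, b1⟩ := A.p11_mem
  rw [ωo_eq]
  constructor
  · rw [le_div_iff₀ h1]
    nlinarith
  · rw [div_le_iff₀ h1]
    nlinarith

theorem ωo_le_T_p11 (hA : A.p11 < A.p01) : A.ωo ≤ A.T A.p11 := by
  rw [← T_ωo hA]
  exact T_antitone hA (ωo_mem hA).1

/-- `T` is decreasing with values at least `p11`, so `T p11 ≤ ω` makes `[p11, ω]` invariant. Only
`p01` is active. -/
theorem TieAt.subsidy_eq_of_T_p11_le {β m ω : ℝ} (hβ : 0 ≤ β) (hβ1 : β < 1)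
    (h : A.TieAt β m ω) (hω : ω ∈ Set.Icc (0 : ℝ) 1) (hA : A.p11 < A.p01)
    (hT : A.T A.p11 ≤ ω) (h1 : ω < A.p01) :
    m = (β * A.p01 + ω * (1 - β)) / (1 + β * (A.p01 - ω)) * A.B := by
  have hp : A.p11 ≤ ω := (T_mem_Icc hA A.p11_mem).1.trans hT
  have maps : Set.MapsTo A.T (Set.Icc A.p11 ω) (Set.Icc A.p11 ω) := fun x hx =>
    ⟨(T_mem_Icc hA ⟨A.p11_mem.1.trans hx.1, hx.2.trans hω.2⟩).1, (T_antitone hA hx.1).trans hT⟩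
  have hV : ∀ y ∈ Set.Icc A.p11 ω, (1 - β) * A.V β m y = m := fun y hy =>
    h.V_of_mapsTo hβ hβ1 A.p11_mem.1 le_rfl hω.2 maps hy
  have eT := hV (A.T ω) (maps ⟨hp, le_rfl⟩)
  have e1 := hV A.p11 ⟨le_rfl, hp⟩
  have e0 := h.active _ A.p01_mem h1.le
  have e := h.eq hω
  have h1β : 1 - β ≠ 0 := by linarith
  have hd : 0 < 1 + β * (A.p01 - ω) := by nlinarith
  rw [div_mul_eq_mul_div, eq_div_iff hd.ne']
  apply mul_left_cancel₀ h1β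
  generalize A.V β m A.p11 = a at *
  generalize A.V β m A.p01 = b at *
  generalize A.V β m (A.T ω) = c at *
  linear_combination (1 - β) * (1 - β * (1 - A.p01)) * e - β * (1 - β * (1 - A.p01)) * eT
    + β * (1 - ω) * (1 - β) * e0
    + (β * ω * (1 - β * (1 - A.p01)) + β * (1 - ω) * β * A.p01) * e1

/-- The value of `p11`, in terms of `C3` and `C4`, when `p11` is passive and the states `T p11` and
`p01` are active. -/
theorem TieAt.V_p11 {A : Arm} {β m ω : ℝ} (hβ : 0 ≤ β) (h : A.TieAt β m ω)
    (hA : A.p11 < A.p01) (h1 : A.p11 ≤ ω) (hT : ω ≤ A.T A.p11) :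
    (1 - β) * A.V β m A.p11 = A.C3 β * m + A.C4 β * A.B := by
  have hD := den34_pos hβ hA
  have e1 := h.passive _ A.p11_mem h1
  have eT := h.active _ (A.T_mem A.p11_mem) hT
  have e0 := h.active _ A.p01_mem (hT.trans (T_mem_Icc hA A.p11_mem).2)
  have : (1 - β) * A.V β m A.p11 * A.den34 β =
      (1 - β * (1 - A.p01)) * m + (β * A.T A.p11 * (1 - β) + β ^ 2 * A.p01) * A.B := by
    rw [den34]
    generalize A.V β m A.p01 = b at *
    generalize A.V β m A.p11 = a at *
    generalize A.V β m (A.T A.p11) = c at *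
    generalize A.T A.p11 = t at *
    linear_combination (1 - β * (1 - A.p01)) * e1 + β * (1 - β * (1 - A.p01)) * eT
      + β ^ 2 * (1 - t) * e0
  rw [C3, C4]
  field_simp
  linear_combination this

/-- Passive beliefs from `ω` oscillate inside `[T ω, ω]`, so `ω` itself is worth `m / (1 - β)`;
equating this with its active value replaces the tie equation. -/
theorem TieAt.subsidy_eq_of_ωo_le_of_lt_T_p11 {β m ω : ℝ} (hβ : 0 ≤ β) (hβ1 : β < 1)
    (h : A.TieAt β m ω) (hω : ω ∈ Set.Icc (0 : ℝ) 1) (hA : A.p11 < A.p01)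
    (ho : A.ωo ≤ ω) (hT : ω < A.T A.p11) :
    m = (1 - β + β * A.C4 β) * (β * A.p01 + ω * (1 - β))
        / (1 - β * (1 - A.p01) - A.C3 β * (β ^ 2 * A.p01 + β * ω - β ^ 2 * ω)) * A.B := by
  have hS := one_sub_mul_one_sub_p01_pos (A := A) hβ hβ1
  have hD := den34_pos hβ hA
  have hp : A.p11 ≤ ω := (ωo_mem hA).1.trans ho
  have hTp := (T_mem_Icc hA A.p11_mem).2
  have hTω := A.T_le_self ho
  have hTT : A.T (A.T ω) ≤ ω := by
    have hρ : A.p11 - A.p01 < 1 := by linarith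
    have d1 := A.T_sub_self hρ ω
    have d2 := A.T_sub_self hρ (A.T ω)
    -- Two steps scale the deviation from `ωo` by a square that is at most `1`, so the oscillation
    -- does not grow.
    have hx : A.T (A.T ω) - ω = (A.ωo - ω) * (1 - (A.p11 - A.p01) ^ 2) := by
      linear_combination d2 + (A.p11 - A.p01) * d1
    have h2 : (A.p11 - A.p01) ^ 2 ≤ 1 := by
      have := A.p01_mem.2
      have := A.p11_mem.1
      rw [sq_le_one_iff_abs_le_one, abs_le]
      constructor <;> linarith
    nlinarith
  have maps : Set.MapsTo A.T (Set.Icc (A.T ω) ω) (Set.Icc (A.T ω) ω) := fun x hx =>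
    ⟨T_antitone hA hx.2, (T_antitone hA hx.1).trans hTT⟩
  have eω := h.V_of_mapsTo hβ hβ1 (A.T_mem hω).1 le_rfl hω.2 maps ⟨hTω, le_rfl⟩
  have ea := h.active ω hω le_rfl
  have e1 := h.V_p11 hβ hA hp hT.le
  have e0 := h.active _ A.p01_mem (hT.le.trans hTp)
  have hd : 0 < 1 - β * (1 - A.p01) - A.C3 β * (β ^ 2 * A.p01 + β * ω - β ^ 2 * ω) := by
    have e : 1 - β * (1 - A.p01) - A.C3 β * (β ^ 2 * A.p01 + β * ω - β ^ 2 * ω) =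
        (1 - β * (1 - A.p01)) * (A.den34 β - (β ^ 2 * A.p01 + β * ω - β ^ 2 * ω)) / A.den34 β := by
      rw [C3]
      field_simp
    rw [e]
    refine div_pos (mul_pos hS ?_) hD
    have i1 := mul_le_mul_of_nonneg_left hTp (sq_nonneg β)
    have i2 : 0 ≤ β * (1 - β) * (A.p01 - ω) :=
      mul_nonneg (mul_nonneg hβ (by linarith)) (by linarith)
    unfold den34
    linarith
  rw [div_mul_eq_mul_div, eq_div_iff hd.ne']
  rw [ea] at eω
  generalize A.V β m A.p01 = b at *
  generalize A.V β m A.p11 = a at *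
  generalize A.C3 β = c3 at *
  generalize A.C4 β = c4 at *
  linear_combination -(1 - β * (1 - A.p01)) * eω + β * (1 - ω) * (1 - β) * e0
    + (β * ω * (1 - β * (1 - A.p01)) + β * (1 - ω) * β * A.p01) * e1

/-- `T ω` and `p01` are active, and `p11` is passive for exactly one slot because `T p11 ≥ ωo > ω`.
-/
theorem TieAt.subsidy_eq_of_lt_ωo_of_p11_lt {β m ω : ℝ} (hβ : 0 ≤ β) (hβ1 : β < 1)
    (h : A.TieAt β m ω) (hω : ω ∈ Set.Icc (0 : ℝ) 1) (hA : A.p11 < A.p01)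
    (hp : A.p11 < ω) (ho : ω < A.ωo) :
    m = ((1 - β) * (β * A.p01 + ω - β * A.T ω)
          - A.C4 β * β * (β * A.T ω - β * A.p01 - ω))
        / (1 - β * (1 - A.p01)
          + A.C3 β * β * (β * A.T ω - β * A.p01 - ω)) * A.B := by
  have hS := one_sub_mul_one_sub_p01_pos (A := A) hβ hβ1
  have hD := den34_pos hβ hA
  have hT : ω ≤ A.T A.p11 := ho.le.trans (ωo_le_T_p11 hA)
  have hTp := (T_mem_Icc hA A.p11_mem).2
  have hTω := A.self_lt_T hω.1 ho
  have e := h.eq hω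
  have eT := h.active _ (A.T_mem hω) hTω.le
  have e1 := h.V_p11 hβ hA hp.le hT
  have e0 := h.active _ A.p01_mem (hT.trans hTp)
  have hd : 0 < 1 - β * (1 - A.p01) + A.C3 β * β * (β * A.T ω - β * A.p01 - ω) := by
    have e : 1 - β * (1 - A.p01) + A.C3 β * β * (β * A.T ω - β * A.p01 - ω) =
        (1 - β * (1 - A.p01)) * (A.den34 β + β * (β * A.T ω - β * A.p01 - ω)) / A.den34 β := by
      rw [C3]
      field_simp
    rw [e]
    -- By `T p11 ≤ p01` and `ω ≤ T ω`, this factor is at least `1 + β (1 - β) (p01 - ω)`.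
    refine div_pos (mul_pos hS ?_) hD
    have i1 := mul_le_mul_of_nonneg_left hTp (sq_nonneg β)
    have i2 : 0 ≤ β * (1 - β) * (A.p01 - ω) :=
      mul_nonneg (mul_nonneg hβ (by linarith)) (by linarith)
    have i3 := mul_le_mul_of_nonneg_left hTω.le (sq_nonneg β)
    unfold den34
    linarith
  rw [div_mul_eq_mul_div, eq_div_iff hd.ne']
  generalize A.V β m A.p01 = b at *
  generalize A.V β m A.p11 = a at *
  generalize A.V β m (A.T ω) = c at *
  generalize A.C3 β = c3 at *
  generalize A.C4 β = c4 at *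
  generalize A.T ω = x at *
  linear_combination (1 - β * (1 - A.p01)) * e - (1 - β * (1 - A.p01)) * β * eT
    - (β ^ 2 * (1 - x) - β * (1 - ω)) * e0 - β * (β * x - β * A.p01 - ω) * e1

end Negative

/-! ### Indexability and the index formulas -/

theorem exists_tie_unique {β : ℝ} (hβ : 0 ≤ β) (hβ1 : β < 1) {ω : ℝ}
    (hω : ω ∈ Set.Icc (0 : ℝ) 1) : ∃ w, ∀ m, A.TieAt β m ω → m = w := by
  rcases le_or_gt A.p01 A.p11 with hA | hA
  · rcases le_or_gt ω A.p01 with h0 | h0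
    · exact ⟨_, fun m h => h.subsidy_eq_of_le hω h0 (h0.trans hA)⟩
    rcases le_or_gt A.p11 ω with h1 | h1
    · exact ⟨_, fun m h => h.subsidy_eq_of_ge hβ hβ1 hω h0.le h1⟩
    rcases le_or_gt A.ωo ω with ho | ho
    · exact ⟨_, fun m h => h.subsidy_eq_of_ωo_le hβ hβ1 hω hA ho h1⟩
    · exact ⟨_, fun m h => h.subsidy_eq_of_lt_ωo hβ hβ1 hω hA ho⟩
  · rcases le_or_gt ω A.p11 with h1 | h1
    · exact ⟨_, fun m h => h.subsidy_eq_of_le hω (h1.trans hA.le) h1⟩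
    rcases le_or_gt A.p01 ω with h0 | h0
    · exact ⟨_, fun m h => h.subsidy_eq_of_ge hβ hβ1 hω h0 h1.le⟩
    rcases le_or_gt A.ωo ω with ho | ho
    · rcases le_or_gt (A.T A.p11) ω with hT | hT
      · exact ⟨_, fun m h => h.subsidy_eq_of_T_p11_le hβ hβ1 hω hA hT h0⟩
      · exact ⟨_, fun m h => h.subsidy_eq_of_ωo_le_of_lt_T_p11 hβ hβ1 hω hA ho hT⟩
    · exact ⟨_, fun m h => h.subsidy_eq_of_lt_ωo_of_p11_lt hβ hβ1 hω hA h1 ho⟩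

end Whittle.Arm

theorem theorem2 (A : Whittle.Arm) (β : ℝ) (hβ0 : 0 ≤ β) (hβ1 : β < 1) :
    A.Indexable β ∧
    -- positively correlated channel
    (A.p01 ≤ A.p11 → ∀ ω ∈ Set.Icc (0 : ℝ) 1,
      (ω ≤ A.p01 ∨ A.p11 ≤ ω → A.whittleIndex β ω = ω * A.B) ∧
      (A.ωo ≤ ω → ω < A.p11 →
        A.whittleIndex β ω = ω / (1 - β * A.p11 + β * ω) * A.B) ∧
      (A.p01 < ω → ω < A.ωo →
        A.crossingTime A.p01 ω ≠ ⊤ ∧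
        A.whittleIndex β ω =
          (ω - β * A.T ω
              + A.C2 β ω * (1 - β) * (β * (1 - β * A.p11) - β * (ω - β * A.T ω)))
            / (1 - β * A.p11
              - A.C1 β ω * (β * (1 - β * A.p11) - β * (ω - β * A.T ω))) * A.B)) ∧
    -- negatively correlated channel
    (A.p11 < A.p01 → ∀ ω ∈ Set.Icc (0 : ℝ) 1,
      (ω ≤ A.p11 ∨ A.p01 ≤ ω → A.whittleIndex β ω = ω * A.B) ∧
      (A.T A.p11 ≤ ω → ω < A.p01 →
        A.whittleIndex β ω =
          (β * A.p01 + ω * (1 - β)) / (1 + β * (A.p01 - ω)) * A.B) ∧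
      (A.ωo ≤ ω → ω < A.T A.p11 →
        A.whittleIndex β ω =
          (1 - β + β * A.C4 β) * (β * A.p01 + ω * (1 - β))
            / (1 - β * (1 - A.p01) - A.C3 β * (β ^ 2 * A.p01 + β * ω - β ^ 2 * ω)) * A.B) ∧
      (A.p11 < ω → ω < A.ωo →
        A.whittleIndex β ω =
          ((1 - β) * (β * A.p01 + ω - β * A.T ω)
              - A.C4 β * β * (β * A.T ω - β * A.p01 - ω))
            / (1 - β * (1 - A.p01)
              + A.C3 β * β * (β * A.T ω - β * A.p01 - ω)) * A.B)) := by
  refine ⟨A.indexable_of_forall_exists hβ0 hβ1 fun ω hω => A.exists_tie_unique hβ0 hβ1 hω,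
    fun hA ω hω => ⟨?_, ?_, ?_⟩, fun hA ω hω => ⟨?_, ?_, ?_, ?_⟩⟩
  · rintro (h | h) <;> refine A.whittleIndex_eq hβ0 hβ1 hω fun m ht => ?_
    · exact ht.subsidy_eq_of_le hω h (h.trans hA)
    · exact ht.subsidy_eq_of_ge hβ0 hβ1 hω (hA.trans h) h
  · exact fun ho h1 => A.whittleIndex_eq hβ0 hβ1 hω fun m ht =>
      ht.subsidy_eq_of_ωo_le hβ0 hβ1 hω hA ho h1
  · exact fun _ ho =>
      ⟨(Whittle.Arm.crossingTime_spec (Whittle.Arm.exists_lt_iterate hω.1 ho)).1,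
        A.whittleIndex_eq hβ0 hβ1 hω fun m ht => ht.subsidy_eq_of_lt_ωo hβ0 hβ1 hω hA ho⟩
  · rintro (h | h) <;> refine A.whittleIndex_eq hβ0 hβ1 hω fun m ht => ?_
    · exact ht.subsidy_eq_of_le hω (h.trans hA.le) h
    · exact ht.subsidy_eq_of_ge hβ0 hβ1 hω h (hA.le.trans h)
  · exact fun hT h1 => A.whittleIndex_eq hβ0 hβ1 hω fun m ht =>
      ht.subsidy_eq_of_T_p11_le hβ0 hβ1 hω hA hT h1
  · exact fun ho hT => A.whittleIndex_eq hβ0 hβ1 hω fun m ht =>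
      ht.subsidy_eq_of_ωo_le_of_lt_T_p11 hβ0 hβ1 hω hA ho hT
  · exact fun hp ho => A.whittleIndex_eq hβ0 hβ1 hω fun m ht =>
      ht.subsidy_eq_of_lt_ωo_of_p11_lt hβ0 hβ1 hω hA hp ho
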